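/- Let $q\ge 5$ be a prime power and let $\mathbb{F}_q^+=\mathbb{F}_q\cup\{\infty\}$. For $t\in\mathbb{F}_q$ put $P(t)=(1,t,t^2,t^3)$, and put $P(\infty)=(0,0,0,1)$; these are the points, in homogeneous coordinates, of the twisted cubic in $\mathrm{PG}(3,q)$. Let $\mathcal{C}$ be the linear code of length $q+1$ over $\mathbb{F}_q$, with coordinates indexed by $\mathbb{F}_q^+$, that has a parity check matrix whose column at $t\in\mathbb{F}_q^+$ is $m_tP(t)^{tr}$, where the $m_t$ are arbitrary nonzero elements of $\mathbb{F}_q$ (a choice of homogeneous coordinates for each point; e.g. all $m_t=1$). For $w\ge 0$ let $A_w$ be the number of codewords of $\mathcal{C}$ of Hamming weight $w$. Let $\mathcal{V}=\mathbf{v}+\mathcal{C}$ be a coset of $\mathcal{C}$ of weight $3$, i.e. the smallest Hamming weight of a vector in $\mathcal{V}$ is $3$, and let $B_w$ be the number of vectors of Hamming weight $w$ in $\mathcal{V}$. Then $B_0=B_1=B_2=0$, $$B_3\in\begin{cases}\left\{\frac{q^2-3q+2}{6},\ \frac{q^2-q}{6}\right\} & \text{if } q\equiv 1\pmod 3,\\[2pt]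 \left\{\frac{q^2-3q+2}{6},\ \frac{q^2-q-2}{6},\ \frac{q^2-q+4}{6}\right\} & \text{if } q\equiv -1\pmod 3,\\[2pt] \left\{\frac{q^2-3q}{6},\ \frac{q^2-q}{6}\right\} & \text{if } q\equiv 0\pmod 3,\end{cases}$$ $$B_4=\binom{q+1}{4}-(q-2)B_3,$$ and, for every $w\ge 5$, $$B_w=A_w+(-1)^w\left[\binom{q+1}{w}\binom{w-1}{3}-\binom{q-2}{w-3}B_3\right].$$ -/

import Mathlib

/-- The points of the twisted cubic of `PG(3, F)` in homogeneous coordinates: `some t` stands for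
the parameter `t ∈ F`, giving `(1, t, t ^ 2, t ^ 3)`, and `none` for the parameter `∞`, giving
`(0, 0, 0, 1)`. -/
def cubicPoint {F : Type*} [Field F] : Option F → Fin 4 → F
  | some t => ![1, t, t ^ 2, t ^ 3]
  | none => ![0, 0, 0, 1]

/-- The `4 × (q + 1)` matrix whose columns are the points of the twisted cubic in homogeneous
coordinates, the coordinate vector of the point with parameter `t` being scaled by `m t`. -/
def cubicParityCheck {F : Type*} [Field F] (m : Option F → F) : Matrix (Fin 4) (Option F) F :=
  Matrix.of fun i t => m t * cubicPoint t i

/-- The linear code of length `q + 1` with parity check matrix `cubicParityCheck m`. -/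
def cubicCode {F : Type*} [Field F] [Fintype F] (m : Option F → F) :
    Submodule F (Option F → F) :=
  LinearMap.ker (cubicParityCheck m).mulVecLin

/-- `V` is a coset (a translate) of the linear code `C`. -/
def IsCodeCoset {F ι : Type*} [Field F] (C : Submodule F (ι → F)) (V : Set (ι → F)) : Prop :=
  ∃ v : ι → F, V = {x | ∃ c ∈ C, x = c + v}

/-- The number of vectors of Hamming weight `w` in `V`. -/
noncomputable def weightCount {F ι : Type*} [Field F] [DecidableEq F] [Fintype ι]
    (V : Set (ι → F)) (w : ℕ) : ℕ :=
  {x ∈ V | hammingNorm x = w}.ncard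

/-- The smallest Hamming weight of a vector in `V` (meaningful for nonempty `V`; cosets are). -/
noncomputable def minWeight {F ι : Type*} [Field F] [DecidableEq F] [Fintype ι]
    (V : Set (ι → F)) : ℕ :=
  sInf (hammingNorm '' V)

/-! ### Möbius inversion over supports. -/

section InclusionExclusion

open Finset

variable {ι K : Type*} [Zero K] [DecidableEq K]

/-! A coset of the code is the set of vectors with a fixed syndrome `s`. Any four columns form a
basis (`eq_zero_of_mulVec_eq_zero`), so for a set `S` of at least four coordinates the coset and the
code have equally many vectors supported in `S`. For smaller `S` the code contributes only `0`, and
the coset contributes only coset leaders with `#S = 3`. Inclusion-exclusion then makes `B_w - A_w` a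
function of `B_3` alone (`card_weight_eq`).

`B_3` counts the planes through three points of the cubic that contain `s`. Such a plane condition
is the vanishing of a symmetric trilinear form `polar s a b c`. For `a ≠ b`, weight three means that
`s` is not on the chord `ab`, so exactly one `c` solves it; the bad cases are `c = a` and `c = b`.
Counting these with `z` zeros of the cubic form `polar s a a a` and `t` tangents through `s` gives
`6 B_3 = q² - q - 2 - 2qt + 2z` (`card_weight_three_eq`). Here `t ≤ 1`, and `z ≤ 3` unless `3 ∣ q`,
`z = q + 1`, `t = 1`. Divisibility by three alone then leaves the listed values. -/

theorem sum_powerset_ite_card_le_three (T : Finset ι) (hT : 4 ≤ #T) :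
    ∑ S ∈ T.powerset, (-1 : ℤ) ^ #S * (if #S ≤ 3 then 1 else 0) = -((#T - 1).choose 3 : ℤ) := by
  rw [sum_powerset_apply_card (fun k => (-1 : ℤ) ^ k * (if k ≤ 3 then 1 else 0))]
  obtain ⟨n, hn⟩ := Nat.exists_eq_add_of_le hT
  have h2 := @Int.alternating_sum_range_choose_eq_choose (#T - 1) 3
  rw [Nat.sub_add_cancel (by omega)] at h2
  -- Only sizes 0 to 3 contribute, and the truncated alternating sum of binomials has the closed
  -- form `(-1)^3 * (#T - 1).choose 3`.
  rw [← sum_subset (s₁ := range (3 + 1)) (range_subset_range.2 (by omega))]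
  · calc _ = ∑ k ∈ range (3 + 1), ((-1) ^ k * ((#T).choose k : ℤ)) := by
          refine sum_congr rfl fun k hk => ?_
          rw [mem_range] at hk
          rw [if_pos (by omega), nsmul_eq_mul]
          ring
      _ = _ := by rw [h2]; ring
  · intro k _ hk
    rw [mem_range] at hk
    simp [show ¬ k ≤ 3 by omega]

variable [Fintype ι]

/-- The support of a vector. -/
def vecSupport (x : ι → K) : Finset ι := {i | x i ≠ 0}

@[simp] theorem mem_vecSupport {x : ι → K} {i : ι} : i ∈ vecSupport x ↔ x i ≠ 0 := by
  simp [vecSupport]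

theorem card_vecSupport (x : ι → K) : #(vecSupport x) = hammingNorm x := rfl

variable [DecidableEq ι]

/-- Möbius inversion on the Boolean lattice: the sets between `U` and `T` are `U ∪ R` with `R ⊆ T \
U`, and their signs cancel unless `T \ U` is empty. -/
theorem sum_powerset_ite_subset (U T : Finset ι) :
    ∑ S ∈ T.powerset, (-1 : ℤ) ^ (#T + #S) * (if U ⊆ S then 1 else 0) =
      if U = T then 1 else 0 := by
  by_cases hUT : U ⊆ T
  · have h1 : ∑ S ∈ T.powerset, (-1 : ℤ) ^ (#T + #S) * (if U ⊆ S then 1 else 0) =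
        ∑ R ∈ (T \ U).powerset, (-1 : ℤ) ^ (#T + #U) * (-1) ^ #R := by
      simp only [mul_ite, mul_one, mul_zero]
      rw [← sum_filter]
      refine sum_bij' (fun S _ => S \ U) (fun R _ => R ∪ U) ?_ ?_ ?_ ?_ ?_
      · intro S hS
        simp only [mem_filter, mem_powerset] at hS ⊢
        exact sdiff_subset_sdiff hS.1 subset_rfl
      · intro R hR
        simp only [mem_filter, mem_powerset] at hR ⊢
        exact ⟨union_subset (hR.trans sdiff_subset) hUT, subset_union_right⟩
      · intro S hS
        simp only [mem_filter, mem_powerset] at hS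
        exact sdiff_union_of_subset hS.2
      · intro R hR
        rw [mem_powerset] at hR
        exact union_sdiff_cancel_right (disjoint_of_subset_left hR sdiff_disjoint)
      · intro S hS
        simp only [mem_filter, mem_powerset] at hS
        rw [← card_sdiff_add_card_eq_card hS.2, ← pow_add]
        congr 1
        ring
    rw [h1, ← mul_sum, sum_powerset_neg_one_pow_card]
    by_cases h : U = T
    · subst h
      simp [← two_mul, pow_mul]
    · have : ¬ T ⊆ U := fun h' => h (subset_antisymm hUT h')
      simp [h, sdiff_eq_empty_iff_subset, this]
  · have h : U ≠ T := by
      rintro rfl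
      exact hUT subset_rfl
    rw [if_neg h]
    refine sum_eq_zero fun S hS => ?_
    rw [if_neg fun h' => hUT (h'.trans (mem_powerset.1 hS)), mul_zero]

/-- The number of vectors of weight `w` in terms of the numbers of vectors with support in given
sets. -/
theorem card_filter_hammingNorm_eq_sum (W : Finset (ι → K)) (w : ℕ) :
    (#{x ∈ W | hammingNorm x = w} : ℤ) =
      ∑ T ∈ powersetCard w univ, ∑ S ∈ T.powerset,
        (-1) ^ (w + #S) * (#{x ∈ W | vecSupport x ⊆ S} : ℤ) := by
  have h1 : ∀ T ∈ powersetCard w (univ : Finset ι), ∑ S ∈ T.powerset,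
      (-1) ^ (w + #S) * (#{x ∈ W | vecSupport x ⊆ S} : ℤ) =
        ∑ x ∈ W, if vecSupport x = T then 1 else 0 := by
    intro T hT
    rw [mem_powersetCard] at hT
    simp_rw [← sum_powerset_ite_subset]
    rw [sum_comm]
    refine sum_congr rfl fun S _ => ?_
    rw [← mul_sum, hT.2]
    congr 1
    simp
  rw [sum_congr rfl h1, sum_comm, card_filter, Nat.cast_sum]
  refine sum_congr rfl fun x _ => ?_
  rw [sum_ite_eq]
  simp [card_vecSupport]

/-- Each `k`-set lies in the same number of `w`-sets, which is the binomial factor. -/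
theorem sum_powersetCard_sum_powersetCard (h : Finset ι → ℤ) {k w : ℕ} (hkw : k ≤ w) :
    ∑ T ∈ powersetCard w (univ : Finset ι), ∑ S ∈ powersetCard k T, h S =
      ((Fintype.card ι - k).choose (w - k) : ℤ) * ∑ S ∈ powersetCard k univ, h S := by
  have h1 : ∀ T ∈ powersetCard w (univ : Finset ι), ∑ S ∈ powersetCard k T, h S =
      ∑ S ∈ powersetCard k (univ : Finset ι), if S ⊆ T then h S else 0 := by
    intro T _
    rw [← sum_filter]
    refine sum_congr ?_ fun _ _ => rfl
    ext S
    simp [mem_powersetCard, and_comm]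
  rw [sum_congr rfl h1, sum_comm, mul_sum]
  refine sum_congr rfl fun S hS => ?_
  rw [mem_powersetCard] at hS
  rw [← sum_filter, sum_const, card_filter_powersetCard_subset S univ w hS.1 (hS.2.trans_le hkw),
    hS.2, card_univ, nsmul_eq_mul]

/-- Signed sums over flags of a set function concentrated on the sets with at most three
elements. -/
theorem sum_powersetCard_sum_powerset_of_card_le_three (N h : Finset ι → ℤ)
    (hN : ∀ S, N S = (if #S = 3 then h S else 0) - (if #S ≤ 3 then 1 else 0))
    {w : ℕ} (hw : 4 ≤ w) :
    ∑ T ∈ powersetCard w (univ : Finset ι), ∑ S ∈ T.powerset, (-1) ^ (w + #S) * N S =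
      (-1) ^ w * (((Fintype.card ι).choose w : ℤ) * ((w - 1).choose 3 : ℤ) -
        ((Fintype.card ι - 3).choose (w - 3) : ℤ) * ∑ S ∈ powersetCard 3 univ, h S) := by
  have h1 : ∀ T ∈ powersetCard w (univ : Finset ι),
      ∑ S ∈ T.powerset, (-1) ^ (w + #S) * N S =
        (-1) ^ w * (((w - 1).choose 3 : ℤ) - ∑ S ∈ powersetCard 3 T, h S) := by
    intro T hT
    rw [mem_powersetCard] at hT
    have e := sum_powerset_ite_card_le_three T (hT.2 ▸ hw)
    have e2 : ∑ S ∈ T.powerset, (-1 : ℤ) ^ #S * (if #S = 3 then h S else 0) =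
        -∑ S ∈ powersetCard 3 T, h S := by
      rw [powersetCard_eq_filter, sum_filter, ← sum_neg_distrib]
      refine sum_congr rfl fun S _ => ?_
      split_ifs with h3
      · rw [h3]; ring
      · ring
    rw [hT.2] at e
    rw [← neg_eq_iff_eq_neg.2 e, sub_eq_add_neg _ (∑ S ∈ powersetCard 3 T, h S), ← e2,
      ← sum_neg_distrib, ← sum_add_distrib, mul_sum]
    refine sum_congr rfl fun S _ => ?_
    rw [hN S]
    ring
  rw [sum_congr rfl h1, ← mul_sum, sum_sub_distrib,
    sum_powersetCard_sum_powersetCard h (by omega), sum_const, card_powersetCard, card_univ,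
    nsmul_eq_mul]

end InclusionExclusion

/-! ### The trilinear form detecting planes and chords through a point. -/

section PolarForm

open Finset

variable {F : Type*} [Field F]

/-- Homogeneous coordinates `(1, t)`, resp. `(0, 1)`, on the projective line. -/
def lineX : Option F → F
  | some _ => 1
  | none => 0

/-- The second homogeneous coordinate on the projective line. -/
def lineY : Option F → F
  | some t => t
  | none => 1

/-- The bracket of two points of the projective line. -/
def bracket (a b : Option F) : F := lineX a * lineY b - lineY a * lineX b

theorem bracket_eq_zero_iff {a b : Option F} : bracket a b = 0 ↔ a = b := by
  rcases a with _ | a <;> rcases b with _ | b <;> simp [bracket, lineX, lineY, sub_eq_zero, eq_comm]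

/-- The coordinates of the plane through the points `a`, `b`, `c` of the twisted cubic. -/
def planeCoords (a b c : Option F) : Fin 4 → F :=
  ![-(lineY a * lineY b * lineY c),
    lineX a * lineY b * lineY c + lineY a * lineX b * lineY c + lineY a * lineY b * lineX c,
    -(lineX a * lineX b * lineY c + lineX a * lineY b * lineX c + lineY a * lineX b * lineX c),
    lineX a * lineX b * lineX c]

/-- The symmetric trilinear form on the projective line attached to a point `s`. -/
def polar (s : Fin 4 → F) (a b c : Option F) : F := planeCoords a b c ⬝ᵥ s

theorem polar_eq (s : Fin 4 → F) (a b c : Option F) : polar s a b c =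
    -(lineY a * lineY b * lineY c) * s 0 +
    (lineX a * lineY b * lineY c + lineY a * lineX b * lineY c + lineY a * lineY b * lineX c) * s 1
    - (lineX a * lineX b * lineY c + lineX a * lineY b * lineX c + lineY a * lineX b * lineX c) * s 2
    + lineX a * lineX b * lineX c * s 3 := by
  simp [polar, planeCoords, dotProduct, Fin.sum_univ_four]
  ring

theorem polar_zero (a b c : Option F) : polar (0 : Fin 4 → F) a b c = 0 := by simp [polar_eq]

theorem polar_right_comm (s : Fin 4 → F) (a b c : Option F) : polar s a b c = polar s a c b := by
  simp only [polar_eq]; ring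

theorem polar_left_comm (s : Fin 4 → F) (a b c : Option F) : polar s a b c = polar s b a c := by
  simp only [polar_eq]; ring

/-- The plane through `a`, `b`, `c` meets the cubic only there. Hence evaluating the form on a
combination of columns kills the coefficients at `a`, `b`, `c`, which is how single coefficients are
extracted below. -/
theorem polar_cubicPoint (a b c d : Option F) :
    polar (cubicPoint d) a b c = bracket a d * bracket b d * bracket c d := by
  rcases d with _ | d <;>
    simp [polar_eq, bracket, cubicPoint, lineX, lineY] <;> ring

variable [Fintype F]

theorem polar_mulVec (m x : Option F → F) (a b c : Option F) :
    polar ((cubicParityCheck m).mulVec x) a b c =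
      ∑ t, x t * (m t * (bracket a t * bracket b t * bracket c t)) := by
  rw [polar, Matrix.dotProduct_mulVec, dotProduct]
  refine sum_congr rfl fun t _ => ?_
  rw [← polar_cubicPoint, mul_comm, polar]
  congr 1
  simp [Matrix.vecMul, dotProduct, cubicParityCheck, mul_sum]
  exact sum_congr rfl fun i _ => by ring

theorem polar_mulVec_eq_single {m x : Option F → F} {a b c d : Option F}
    (hx : ∀ t, t ≠ a → t ≠ b → t ≠ c → t ≠ d → x t = 0) :
    polar ((cubicParityCheck m).mulVec x) a b c =
      x d * (m d * (bracket a d * bracket b d * bracket c d)) := by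
  rw [polar_mulVec]
  refine sum_eq_single d (fun t _ htd => ?_) (by simp)
  by_cases ha : t = a
  · simp [bracket_eq_zero_iff.2 ha.symm]
  by_cases hb : t = b
  · simp [bracket_eq_zero_iff.2 hb.symm]
  by_cases hc : t = c
  · simp [bracket_eq_zero_iff.2 hc.symm]
  rw [hx t ha hb hc htd, zero_mul]

theorem apply_eq_zero_of_polar_mulVec_eq_zero {m x : Option F → F} (hm : ∀ t, m t ≠ 0)
    {a b c d : Option F} (had : a ≠ d) (hbd : b ≠ d) (hcd : c ≠ d)
    (hx : ∀ t, t ≠ a → t ≠ b → t ≠ c → t ≠ d → x t = 0)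
    (h : polar ((cubicParityCheck m).mulVec x) a b c = 0) : x d = 0 := by
  rw [polar_mulVec_eq_single hx] at h
  have h1 : bracket a d ≠ 0 := fun h => had (bracket_eq_zero_iff.1 h)
  have h2 : bracket b d ≠ 0 := fun h => hbd (bracket_eq_zero_iff.1 h)
  have h3 : bracket c d ≠ 0 := fun h => hcd (bracket_eq_zero_iff.1 h)
  exact (mul_eq_zero.1 h).resolve_right
    (mul_ne_zero (hm d) (mul_ne_zero (mul_ne_zero h1 h2) h3))

variable [DecidableEq F]

/-- Any four points of the twisted cubic are linearly independent. -/
theorem eq_zero_of_mulVec_eq_zero {m x : Option F → F} (hm : ∀ t, m t ≠ 0)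
    {S : Finset (Option F)} (hS : #S = 4) (hx : vecSupport x ⊆ S)
    (h : (cubicParityCheck m).mulVec x = 0) : x = 0 := by
  funext d
  by_contra hd
  have hdS : d ∈ S := hx (by simpa using hd)
  obtain ⟨a, b, c, hab, hac, hbc, habc⟩ := card_eq_three.1 (show #(S.erase d) = 3 by
    rw [card_erase_of_mem hdS, hS])
  have hne : ∀ t ∈ S.erase d, t ≠ d := fun t ht => ne_of_mem_erase ht
  refine hd (apply_eq_zero_of_polar_mulVec_eq_zero hm (hne a (by simp [habc]))
    (hne b (by simp [habc])) (hne c (by simp [habc])) (fun t h1 h2 h3 h4 => ?_)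
    (h ▸ polar_zero a b c))
  by_contra ht
  have : t ∈ S.erase d := mem_erase.2 ⟨h4, hx (by simpa using ht)⟩
  simp [habc, h1, h2, h3] at this

theorem eq_zero_of_mulVec_eq_zero_of_card_le {m x : Option F → F} (hm : ∀ t, m t ≠ 0)
    (hq : 3 ≤ Fintype.card F)
    {S : Finset (Option F)} (hS : #S ≤ 4) (hx : vecSupport x ⊆ S)
    (h : (cubicParityCheck m).mulVec x = 0) : x = 0 := by
  obtain ⟨T, hST, -, hT⟩ := exists_subsuperset_card_eq (subset_univ S) hS
    (by rw [card_univ, Fintype.card_option]; omega)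
  exact eq_zero_of_mulVec_eq_zero hm hT (hx.trans hST) h

theorem vecSupport_sub_subset {x y : Option F → F} {S : Finset (Option F)}
    (hx : vecSupport x ⊆ S) (hy : vecSupport y ⊆ S) : vecSupport (x - y) ⊆ S := by
  intro t ht
  by_contra h
  have h1 : x t = 0 := by by_contra h'; exact h (hx (by simpa using h'))
  have h2 : y t = 0 := by by_contra h'; exact h (hy (by simpa using h'))
  simp [h1, h2] at ht

theorem eq_of_mulVec_eq {m x y : Option F → F} (hm : ∀ t, m t ≠ 0)
    (hq : 3 ≤ Fintype.card F)
    {S : Finset (Option F)} (hS : #S ≤ 4) (hx : vecSupport x ⊆ S) (hy : vecSupport y ⊆ S)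
    (h : (cubicParityCheck m).mulVec x = (cubicParityCheck m).mulVec y) : x = y := by
  refine sub_eq_zero.1 (eq_zero_of_mulVec_eq_zero_of_card_le hm hq hS
    (vecSupport_sub_subset hx hy) ?_)
  rw [Matrix.mulVec_sub, h, sub_self]

/-- Any four points of the twisted cubic span the space. -/
theorem exists_mulVec_eq {m : Option F → F} (hm : ∀ t, m t ≠ 0)
    {S : Finset (Option F)} (hS : #S = 4) (s : Fin 4 → F) :
    ∃ x, vecSupport x ⊆ S ∧ (cubicParityCheck m).mulVec x = s := by
  let E : (S → F) →ₗ[F] (Option F → F) :=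
    { toFun := fun y t => if h : t ∈ S then y ⟨t, h⟩ else 0
      map_add' := fun y z => by funext t; by_cases h : t ∈ S <;> simp [h]
      map_smul' := fun k y => by funext t; by_cases h : t ∈ S <;> simp [h] }
  have hE : ∀ y, vecSupport (E y) ⊆ S := by
    intro y t ht
    by_contra h
    simp [E, h] at ht
  have hinj : Function.Injective ((cubicParityCheck m).mulVecLin ∘ₗ E) := by
    refine (injective_iff_map_eq_zero _).2 fun y hy => ?_
    have h0 := eq_zero_of_mulVec_eq_zero hm hS (hE y) (by simpa using hy)
    funext t
    simpa [E] using congrFun h0 t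
  have hsurj := (LinearMap.injective_iff_surjective_of_finrank_eq_finrank (by simp [hS])).1 hinj
  obtain ⟨y, hy⟩ := hsurj s
  exact ⟨E y, hE y, by simpa using hy⟩

theorem polar_eq_zero_iff {m : Option F → F} (hm : ∀ t, m t ≠ 0) (hq : 3 ≤ Fintype.card F)
    (s : Fin 4 → F) {a b c : Option F} (hab : a ≠ b) (hac : a ≠ c) (hbc : b ≠ c) :
    polar s a b c = 0 ↔ ∃ x, vecSupport x ⊆ {a, b, c} ∧ (cubicParityCheck m).mulVec x = s := by
  have h3 : #({a, b, c} : Finset (Option F)) = 3 := card_eq_three.2 ⟨a, b, c, hab, hac, hbc, rfl⟩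
  constructor
  · intro h
    -- Expand `s` in the basis given by `a`, `b`, `c` and a fourth point `d`; vanishing of the form
    -- says that the coefficient at `d` is zero.
    obtain ⟨d, -, hd⟩ := exists_mem_notMem_of_card_lt_card (s := {a, b, c})
      (t := (univ : Finset (Option F))) (by rw [h3, card_univ, Fintype.card_option]; omega)
    have h4 : #(insert d ({a, b, c} : Finset (Option F))) = 4 := by
      rw [card_insert_of_notMem hd, h3]
    obtain ⟨x, hx, rfl⟩ := exists_mulVec_eq hm h4 s
    refine ⟨x, ?_, rfl⟩
    simp only [mem_insert, mem_singleton, not_or] at hd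
    have hd0 : x d = 0 := by
      refine apply_eq_zero_of_polar_mulVec_eq_zero hm (Ne.symm hd.1) (Ne.symm hd.2.1)
        (Ne.symm hd.2.2) (fun t h1 h2 h3 h4 => ?_) h
      by_contra ht
      have := hx (mem_vecSupport.2 ht)
      simp [h1, h2, h3, h4] at this
    intro t ht
    have := hx ht
    rw [mem_insert] at this
    rcases this with rfl | h'
    · simp [hd0] at ht
    · exact h'
  · rintro ⟨x, hx, rfl⟩
    rw [polar_mulVec_eq_single (d := a)]
    · simp [bracket_eq_zero_iff.2]
    · intro t h1 h2 h3 _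
      by_contra ht
      have := hx (mem_vecSupport.2 ht)
      simp [h1, h2, h3] at this

/-- The line through `a` and `b` is the intersection of two planes `abc` and `abd`: the first puts
`s` in the span of `a`, `b`, `c`, and the second removes the coefficient at `c`. -/
theorem exists_support_subset_pair {m : Option F → F} (hm : ∀ t, m t ≠ 0)
    (hq : 3 ≤ Fintype.card F) (s : Fin 4 → F) {a b : Option F} (hab : a ≠ b)
    (h : ∀ c, polar s a b c = 0) :
    ∃ x, vecSupport x ⊆ {a, b} ∧ (cubicParityCheck m).mulVec x = s := by
  have h2 : #({a, b} : Finset (Option F)) = 2 := card_pair hab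
  obtain ⟨c, -, hc⟩ := exists_mem_notMem_of_card_lt_card (s := {a, b})
    (t := (univ : Finset (Option F))) (by rw [h2, card_univ, Fintype.card_option]; omega)
  have h3 : #(insert c ({a, b} : Finset (Option F))) = 3 := by
    rw [card_insert_of_notMem hc, h2]
  obtain ⟨d, -, hd⟩ := exists_mem_notMem_of_card_lt_card (s := insert c {a, b})
    (t := (univ : Finset (Option F))) (by rw [h3, card_univ, Fintype.card_option]; omega)
  simp only [mem_insert, mem_singleton, not_or] at hc hd
  obtain ⟨x, hx, hxs⟩ := (polar_eq_zero_iff hm hq s hab (Ne.symm hc.1) (Ne.symm hc.2)).1 (h c)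
  refine ⟨x, fun t ht => ?_, hxs⟩
  have h1 := hx ht
  simp only [mem_insert, mem_singleton] at h1 ⊢
  rcases h1 with h1 | h1 | rfl
  · exact Or.inl h1
  · exact Or.inr h1
  · refine absurd ?_ (mem_vecSupport.1 ht)
    refine apply_eq_zero_of_polar_mulVec_eq_zero (a := a) (b := b) (c := d) hm
      (Ne.symm hc.1) (Ne.symm hc.2) hd.1 (fun u h1 h2 h3 h4 => ?_) (hxs ▸ h d)
    by_contra hu
    have := hx (mem_vecSupport.2 hu)
    simp [h1, h2, h4] at this

end PolarForm

/-! ### Counting zeros of the trilinear form, tangents and cubic zeros. -/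

section Counting

open Finset

variable {F : Type*} [Field F]

theorem polar_eq_lineX_sub_lineY (s : Fin 4 → F) (a b c : Option F) :
    polar s a b c = lineX c * polar s a b (some 0) + lineY c * polar s a b none := by
  simp only [polar_eq, lineX, lineY]; ring

/-- With `a` and `b` fixed the form is linear in the last point, so two distinct projective zeros
make it vanish identically; `key` is interpolation at `c` and `d`. -/
theorem polar_eq_zero_of_two_zeros {s : Fin 4 → F} {a b c d : Option F} (hcd : c ≠ d)
    (hc : polar s a b c = 0) (hd : polar s a b d = 0) (e : Option F) : polar s a b e = 0 := by
  have h : bracket c d ≠ 0 := fun h => hcd (bracket_eq_zero_iff.1 h)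
  have key : bracket c d * polar s a b e =
      bracket e d * polar s a b c + bracket c e * polar s a b d := by
    simp only [polar_eq, bracket]; ring
  rw [hc, hd, mul_zero, mul_zero, add_zero] at key
  exact (mul_eq_zero.1 key).resolve_left h

theorem exists_polar_eq_zero (s : Fin 4 → F) (a b : Option F) : ∃ c, polar s a b c = 0 := by
  by_cases h : polar s a b none = 0
  · exact ⟨none, h⟩
  · refine ⟨some (-polar s a b (some 0) / polar s a b none), ?_⟩
    rw [polar_eq_lineX_sub_lineY]
    simp only [lineX, lineY]
    field_simp
    ring

variable [Fintype F]

theorem three_eq_zero_iff : (3 : F) = 0 ↔ 3 ∣ Fintype.card F := by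
  have h := prime_dvd_char_iff_dvd_card (R := F) 3
  rw [← h, Nat.prime_dvd_prime_iff_eq Nat.prime_three (CharP.char_is_prime F (ringChar F))]
  have h2 := ringChar.spec F 3
  rw [Nat.cast_ofNat] at h2
  rw [h2, Nat.prime_dvd_prime_iff_eq (CharP.char_is_prime F (ringChar F)) Nat.prime_three, eq_comm]

variable [DecidableEq F]

theorem card_filter_polar_eq_zero (s : Fin 4 → F) (a b : Option F) :
    #{c | polar s a b c = 0} = if ∀ c, polar s a b c = 0 then Fintype.card F + 1 else 1 := by
  split_ifs with h
  · simp [h]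
  · obtain ⟨c, hc⟩ := exists_polar_eq_zero s a b
    rw [card_eq_one]
    refine ⟨c, eq_singleton_iff_unique_mem.2 ⟨by simp [hc], fun d hd => ?_⟩⟩
    by_contra hne
    exact h (polar_eq_zero_of_two_zeros hne (by simpa using hd) hc)

/-- The parameters of the points of the twisted cubic whose tangent contains `s`. -/
def tangentParams (s : Fin 4 → F) : Finset (Option F) := {a | ∀ c, polar s a a c = 0}

/-- The zeros on the projective line of the binary cubic form attached to `s`. -/
def cubicZeros (s : Fin 4 → F) : Finset (Option F) := {a | polar s a a a = 0}

/-- If the tangents at `a ≠ b` both contained `s`, then `polar s a b` would vanish at `a` and at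
`b`, putting `s` on the chord. -/
theorem card_tangentParams_le_one {s : Fin 4 → F}
    (hs : ∀ a b, a ≠ b → ¬ ∀ c, polar s a b c = 0) : #(tangentParams s) ≤ 1 := by
  refine card_le_one.2 fun a ha b hb => ?_
  by_contra hab
  simp only [tangentParams, mem_filter, mem_univ, true_and] at ha hb
  refine hs a b hab (polar_eq_zero_of_two_zeros hab ?_ ?_)
  · rw [polar_right_comm]; exact ha b
  · rw [polar_left_comm, polar_right_comm]; exact hb a

/-- Count all pairs `(a, b)` with `polar s a a b = 0`: each `a` has one such `b`, or `q + 1` if its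
tangent contains `s`. The diagonal pairs are the zeros of the cubic form. -/
theorem card_offDiag_polar_self_add (s : Fin 4 → F) :
    #{p ∈ (univ : Finset (Option F)).offDiag | polar s p.1 p.1 p.2 = 0} + #(cubicZeros s) =
      (Fintype.card F + 1) + Fintype.card F * #(tangentParams s) := by
  have h1 : #{p : Option F × Option F | polar s p.1 p.1 p.2 = 0} =
      (Fintype.card F + 1) + Fintype.card F * #(tangentParams s) := by
    rw [card_filter, Fintype.sum_prod_type]
    simp_rw [← card_filter, card_filter_polar_eq_zero]
    have : ∀ a, (if ∀ c, polar s a a c = 0 then Fintype.card F + 1 else 1) =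
        1 + if a ∈ tangentParams s then Fintype.card F else 0 := by
      intro a
      by_cases h : ∀ c, polar s a a c = 0 <;> simp [tangentParams, h, add_comm]
    simp_rw [this]
    rw [sum_add_distrib]
    simp [mul_comm]
  have h2 : #(cubicZeros s) =
      #{p ∈ (univ : Finset (Option F)).diag | polar s p.1 p.1 p.2 = 0} := by
    refine card_nbij (fun a => (a, a)) ?_ ?_ ?_
    · intro a ha
      simpa [cubicZeros] using ha
    · intro a _ b _ h
      exact congrArg Prod.fst h
    · rintro ⟨a, b⟩ h
      simp only [coe_filter, mem_diag, mem_univ, true_and, Set.mem_ofPred_eq] at h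
      obtain ⟨rfl, h⟩ := h
      exact ⟨a, by simpa [cubicZeros] using h, rfl⟩
  rw [← h1, h2, add_comm, ← card_union_of_disjoint, ← filter_union, diag_union_offDiag,
    univ_product_univ]
  exact disjoint_filter_filter (disjoint_diag_offDiag _)

/-- The number of ordered triples of distinct points spanning a plane through `s`. -/
theorem sum_card_polar_eq_zero {s : Fin 4 → F}
    (hs : ∀ a b, a ≠ b → ¬ ∀ c, polar s a b c = 0) :
    ∑ p ∈ (univ : Finset (Option F)).offDiag,
        #{c | c ≠ p.1 ∧ c ≠ p.2 ∧ polar s p.1 p.2 c = 0} +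
      2 * (Fintype.card F + 1) + 2 * (Fintype.card F * #(tangentParams s)) =
        (Fintype.card F + 1) * Fintype.card F + 2 * #(cubicZeros s) := by
  -- The unique zero `c` of `polar s a b` is either a third point, or `a`, or `b`; exactly one of
  -- the three terms is 1.
  have h1 : ∀ p ∈ (univ : Finset (Option F)).offDiag,
      #{c | c ≠ p.1 ∧ c ≠ p.2 ∧ polar s p.1 p.2 c = 0} +
        (if polar s p.1 p.1 p.2 = 0 then 1 else 0) +
        (if polar s p.2 p.2 p.1 = 0 then 1 else 0) = 1 := by
    rintro ⟨a, b⟩ hp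
    have hab : a ≠ b := by simpa using hp
    have e := card_filter_polar_eq_zero s a b
    rw [if_neg (hs a b hab)] at e
    rw [card_filter] at e ⊢
    have e2 : ∀ c, (if polar s a b c = 0 then 1 else 0) =
        (if c ≠ a ∧ c ≠ b ∧ polar s a b c = 0 then 1 else 0) +
        (if c = a then (if polar s a a b = 0 then 1 else 0) else 0) +
        (if c = b then (if polar s b b a = 0 then 1 else 0) else 0) := by
      intro c
      by_cases hca : c = a
      · subst hca
        simp [hab, polar_right_comm s c b c]
      by_cases hcb : c = b
      · subst hcb
        simp [hca, polar_left_comm s a c c, polar_right_comm s c a c]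
      simp [hca, hcb]
    rw [sum_congr rfl fun c _ => e2 c, sum_add_distrib, sum_add_distrib,
      sum_ite_eq' univ a, sum_ite_eq' univ b, if_pos (mem_univ a), if_pos (mem_univ b)] at e
    exact e
  have h2 := sum_congr rfl h1
  rw [sum_add_distrib, sum_add_distrib] at h2
  have h3 : ∑ p ∈ (univ : Finset (Option F)).offDiag,
      (if polar s p.2 p.2 p.1 = 0 then 1 else 0) =
      ∑ p ∈ (univ : Finset (Option F)).offDiag,
      (if polar s p.1 p.1 p.2 = 0 then 1 else 0) := by
    refine sum_nbij' Prod.swap Prod.swap ?_ ?_ ?_ ?_ ?_ <;> simp [eq_comm]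
  have h4 := card_offDiag_polar_self_add s
  rw [card_filter] at h4
  rw [h3, sum_const, offDiag_card, card_univ, Fintype.card_option, smul_eq_mul, mul_one,
    Nat.sub_eq_of_eq_add (show _ = (Fintype.card F + 1) * Fintype.card F + _ by ring)] at h2
  omega

/-- A nonzero binary cubic form has at most three zeros. -/
theorem card_cubicZeros_le_three {s : Fin 4 → F}
    (hs : ¬ (s 0 = 0 ∧ 3 * s 1 = 0 ∧ 3 * s 2 = 0 ∧ s 3 = 0)) : #(cubicZeros s) ≤ 3 := by
  open Polynomial in
  let p : F[X] := C (-s 0) * X ^ 3 + C (3 * s 1) * X ^ 2 + C (-3 * s 2) * X + C (s 3)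
  have heval : ∀ t, p.eval t = polar s (some t) (some t) (some t) := by
    intro t
    simp [p, polar_eq, lineX, lineY]
    ring
  have hp : p ≠ 0 := by
    intro h
    have hc : ∀ n, p.coeff n = 0 := fun n => by rw [h, Polynomial.coeff_zero]
    have h0 := hc 0
    have h1 := hc 1
    have h2 := hc 2
    have h3 := hc 3
    simp only [p] at h0 h1 h2 h3
    rw [Polynomial.coeff_zero_eq_eval_zero] at h0
    simp [Polynomial.coeff_C, -mul_eq_zero, -map_neg, -map_mul] at h0 h1 h2 h3
    exact hs ⟨h3, h2, h1, h0⟩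
  -- The point at infinity is a zero exactly when the leading coefficient vanishes, so it costs one
  -- degree and the total stays at most three.
  have hsub : cubicZeros s ⊆ p.roots.toFinset.image some ∪ if s 0 = 0 then {none} else ∅ := by
    intro a ha
    simp only [cubicZeros, mem_filter, mem_univ, true_and] at ha
    rcases a with _ | t
    · have : s 0 = 0 := by simpa [polar_eq, lineX, lineY] using ha
      simp [this]
    · refine mem_union_left _ (mem_image_of_mem _ ?_)
      simp [hp, heval, ha]
  have hcard : #(p.roots.toFinset.image some) ≤ p.natDegree :=
    card_image_le.trans ((Multiset.toFinset_card_le _).trans (Polynomial.card_roots' p))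
  refine (card_le_card hsub).trans ((card_union_le _ _).trans ?_)
  split_ifs with h
  · have : p.natDegree ≤ 2 := by
      simp only [p, h, neg_zero, map_zero, zero_mul, zero_add]
      compute_degree
    rw [card_singleton]
    omega
  · have : p.natDegree ≤ 3 := by
      simp only [p]
      compute_degree
    rw [card_empty]
    omega

theorem card_cubicZeros_of_eq_zero {s : Fin 4 → F}
    (hs : s 0 = 0 ∧ 3 * s 1 = 0 ∧ 3 * s 2 = 0 ∧ s 3 = 0) :
    #(cubicZeros s) = Fintype.card F + 1 := by
  obtain ⟨h0, h1, h2, h3⟩ := hs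
  have : cubicZeros s = univ := by
    refine eq_univ_of_forall fun a => ?_
    simp only [cubicZeros, mem_filter, mem_univ, true_and, polar_eq, h0, h3]
    linear_combination (lineX a * lineY a ^ 2) * h1 - (lineX a ^ 2 * lineY a) * h2
  rw [this, card_univ, Fintype.card_option]

/-- In characteristic 3 with `s 0 = s 3 = 0`, `polar s a a c` factors as `-(s 1 * lineY a + s 2 *
lineX a) * bracket a c`; the witness is the zero of the first factor. -/
theorem tangentParams_nonempty {s : Fin 4 → F} (h0 : s 0 = 0) (h3 : s 3 = 0)
    (hF : (3 : F) = 0) : (tangentParams s).Nonempty := by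
  by_cases h1 : s 1 = 0
  · refine ⟨none, ?_⟩
    simp [tangentParams, polar_eq, lineX, lineY, h0, h1]
  · refine ⟨some (-s 2 / s 1), ?_⟩
    simp only [tangentParams, mem_filter, mem_univ, true_and]
    intro c
    rw [polar_eq, h0, h3]
    generalize lineX c = x
    generalize lineY c = y
    simp only [lineX, lineY]
    field_simp
    linear_combination (s 2 * x - s 1 * y) * s 2 * s 1 * hF

end Counting

/-! ### Cosets as syndrome classes, and their weight distributions. -/

section Coset

open Finset

variable {F : Type*} [Field F] [Fintype F] [DecidableEq F]

/-- The vectors with syndrome `s`. -/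
def withSyndrome (m : Option F → F) (s : Fin 4 → F) : Finset (Option F → F) :=
  {x | (cubicParityCheck m).mulVec x = s}

theorem mem_withSyndrome {m : Option F → F} {s : Fin 4 → F} {x : Option F → F} :
    x ∈ withSyndrome m s ↔ (cubicParityCheck m).mulVec x = s := by
  simp [withSyndrome]

theorem IsCodeCoset.exists_eq_withSyndrome {m : Option F → F} {V : Set (Option F → F)}
    (hV : IsCodeCoset (cubicCode m) V) : ∃ s, V = withSyndrome m s := by
  obtain ⟨v, rfl⟩ := hV
  refine ⟨(cubicParityCheck m).mulVec v, ?_⟩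
  ext x
  rw [mem_coe, mem_withSyndrome]
  constructor
  · rintro ⟨c, hc, rfl⟩
    have : (cubicParityCheck m).mulVec c = 0 := by simpa [cubicCode] using hc
    rw [Matrix.mulVec_add, this, zero_add]
  · intro h
    refine ⟨x - v, ?_, by simp⟩
    simp [cubicCode, Matrix.mulVec_sub, h]

theorem coe_cubicCode_eq_withSyndrome (m : Option F → F) :
    (cubicCode m : Set (Option F → F)) = withSyndrome m 0 := by
  ext x
  simp [mem_withSyndrome, cubicCode]

theorem weightCount_coe (W : Finset (Option F → F)) (w : ℕ) :
    weightCount (W : Set (Option F → F)) w = #{x ∈ W | hammingNorm x = w} := by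
  rw [weightCount, ← Set.ncard_coe_finset]
  congr 1
  ext x
  simp

/-- Four coordinates inside `S` already carry a vector of syndrome `s`; translating by it matches
the two sets. -/
theorem card_support_subset_eq_of_four_le {m : Option F → F} (hm : ∀ t, m t ≠ 0)
    (s : Fin 4 → F) {S : Finset (Option F)} (hS : 4 ≤ #S) :
    #{x ∈ withSyndrome m s | vecSupport x ⊆ S} = #{x ∈ withSyndrome m 0 | vecSupport x ⊆ S} := by
  obtain ⟨T, hTS, hT⟩ := exists_subset_card_eq hS
  obtain ⟨y, hy, hys⟩ := exists_mulVec_eq hm hT s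
  have hadd : ∀ x : Option F → F, vecSupport x ⊆ S → vecSupport (x + y) ⊆ S := by
    intro x hx
    have : vecSupport (-y) ⊆ S := fun t ht => hTS (hy (by simpa using ht))
    simpa using vecSupport_sub_subset hx this
  refine card_nbij' (· - y) (· + y) ?_ ?_ ?_ ?_
  · intro x hx
    simp only [coe_filter, Set.mem_ofPred_eq, mem_withSyndrome] at hx ⊢
    exact ⟨by rw [Matrix.mulVec_sub, hx.1, hys, sub_self],
      vecSupport_sub_subset hx.2 (hy.trans hTS)⟩
  · intro x hx
    simp only [coe_filter, Set.mem_ofPred_eq, mem_withSyndrome] at hx ⊢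
    exact ⟨by rw [Matrix.mulVec_add, hx.1, hys, zero_add], hadd x hx.2⟩
  · intro x _
    simp
  · intro x _
    simp

theorem card_codeword_support_subset_eq_one {m : Option F → F} (hm : ∀ t, m t ≠ 0)
    (hq : 3 ≤ Fintype.card F) {S : Finset (Option F)} (hS : #S ≤ 4) :
    #{x ∈ withSyndrome m 0 | vecSupport x ⊆ S} = 1 := by
  rw [card_eq_one]
  refine ⟨0, eq_singleton_iff_unique_mem.2 ⟨?_, fun x hx => ?_⟩⟩
  · simp [mem_withSyndrome, vecSupport]
  · rw [mem_filter, mem_withSyndrome] at hx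
    exact eq_zero_of_mulVec_eq_zero_of_card_le hm hq hS hx.2 hx.1

/-- There are no codewords of weight four. -/
theorem card_codeword_weight_four {m : Option F → F} (hm : ∀ t, m t ≠ 0)
    (hq : 3 ≤ Fintype.card F) : #{x ∈ withSyndrome m 0 | hammingNorm x = 4} = 0 := by
  rw [card_eq_zero, filter_eq_empty_iff]
  intro x hx h4
  have := eq_zero_of_mulVec_eq_zero_of_card_le hm hq (h4.le.trans' (card_vecSupport x).le)
    subset_rfl (mem_withSyndrome.1 hx)
  simp [this] at h4

theorem sum_card_support_subset_eq {W : Finset (Option F → F)}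
    (hW : ∀ x ∈ W, 3 ≤ hammingNorm x) :
    ∑ S ∈ powersetCard 3 (univ : Finset (Option F)), #{x ∈ W | vecSupport x ⊆ S} =
      #{x ∈ W | hammingNorm x = 3} := by
  rw [card_eq_sum_card_fiberwise (f := vecSupport) (t := powersetCard 3 univ)]
  · refine sum_congr rfl fun S hS => ?_
    rw [mem_powersetCard] at hS
    congr 1
    ext x
    simp only [mem_filter]
    constructor
    · rintro ⟨hx, hxS⟩
      have : vecSupport x = S := eq_of_subset_of_card_le hxS (by
        rw [hS.2, card_vecSupport]; exact hW x hx)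
      exact ⟨⟨hx, by rw [← card_vecSupport, this, hS.2]⟩, this⟩
    · rintro ⟨⟨hx, -⟩, rfl⟩
      exact ⟨hx, subset_rfl⟩
  · intro x hx
    simp only [coe_filter, Set.mem_ofPred_eq] at hx
    simp [card_vecSupport, hx.2]

/-- The weight distribution of a coset of weight three in terms of the number of its leaders. -/
theorem card_weight_eq {m : Option F → F} (hm : ∀ t, m t ≠ 0) (hq : 3 ≤ Fintype.card F)
    {s : Fin 4 → F} (hs : ∀ x ∈ withSyndrome m s, 3 ≤ hammingNorm x) {w : ℕ} (hw : 4 ≤ w) :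
    (#{x ∈ withSyndrome m s | hammingNorm x = w} : ℤ) =
      #{x ∈ withSyndrome m 0 | hammingNorm x = w} +
        (-1) ^ w * (((Fintype.card F + 1).choose w : ℤ) * ((w - 1).choose 3 : ℤ) -
          ((Fintype.card F - 2).choose (w - 3) : ℤ) *
            #{x ∈ withSyndrome m s | hammingNorm x = 3}) := by
  -- Apply the inversion to the difference of coset and code counts, which vanishes on sets of size
  -- at least four.
  have h := sum_powersetCard_sum_powerset_of_card_le_three (ι := Option F)
    (fun S => (#{x ∈ withSyndrome m s | vecSupport x ⊆ S} : ℤ) -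
      #{x ∈ withSyndrome m 0 | vecSupport x ⊆ S})
    (fun S => (#{x ∈ withSyndrome m s | vecSupport x ⊆ S} : ℤ)) ?_ hw
  · rw [Fintype.card_option, show Fintype.card F + 1 - 3 = Fintype.card F - 2 by omega,
      ← Nat.cast_sum, sum_card_support_subset_eq hs] at h
    rw [← h, card_filter_hammingNorm_eq_sum, card_filter_hammingNorm_eq_sum]
    simp_rw [mul_sub, sum_sub_distrib]
    ring
  · intro S
    by_cases h4 : 4 ≤ #S
    · rw [card_support_subset_eq_of_four_le hm s h4, if_neg (by omega), if_neg (by omega)]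
      ring
    · rw [card_codeword_support_subset_eq_one hm hq (by omega),
        if_pos (show #S ≤ 3 by omega)]
      by_cases h3 : #S = 3
      · simp [h3]
      · rw [if_neg h3, card_eq_zero.2]
        · simp
        · rw [filter_eq_empty_iff]
          intro x hx hxS
          have h1 := hs x hx
          have h2 := card_le_card hxS
          rw [card_vecSupport] at h2
          omega

/-- A leader is determined by its support, and `{a, b, c}` supports one exactly when its plane
contains `s`; no coefficient can vanish because the coset has no lighter vectors. -/
theorem card_weight_three_support_pair {m : Option F → F} (hm : ∀ t, m t ≠ 0)
    (hq : 3 ≤ Fintype.card F) {s : Fin 4 → F} (hs : ∀ x ∈ withSyndrome m s, 3 ≤ hammingNorm x)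
    {a b : Option F} (hab : a ≠ b) :
    #{x ∈ withSyndrome m s | hammingNorm x = 3 ∧ a ∈ vecSupport x ∧ b ∈ vecSupport x} =
      #{c | c ≠ a ∧ c ≠ b ∧ polar s a b c = 0} := by
  have hcard : ∀ c, c ≠ a → c ≠ b → #({a, b, c} : Finset (Option F)) = 3 := fun c h1 h2 =>
    card_eq_three.2 ⟨a, b, c, hab, h1.symm, h2.symm, rfl⟩
  have hex : ∀ c, ∃ x, c ≠ a ∧ c ≠ b ∧ polar s a b c = 0 →
      vecSupport x = {a, b, c} ∧ (cubicParityCheck m).mulVec x = s := by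
    intro c
    by_cases h : c ≠ a ∧ c ≠ b ∧ polar s a b c = 0
    · obtain ⟨x, hx, hxs⟩ := (polar_eq_zero_iff hm hq s hab h.1.symm h.2.1.symm).1 h.2.2
      refine ⟨x, fun _ => ⟨eq_of_subset_of_card_le hx ?_, hxs⟩⟩
      rw [hcard c h.1 h.2.1, card_vecSupport]
      exact hs x (mem_withSyndrome.2 hxs)
    · exact ⟨0, fun h' => absurd h' h⟩
  choose f hf using hex
  symm
  refine card_nbij f ?_ ?_ ?_
  · intro c hc
    simp only [coe_filter, mem_univ, true_and, Set.mem_ofPred_eq, mem_withSyndrome] at hc ⊢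
    obtain ⟨h1, h2⟩ := hf c hc
    rw [← card_vecSupport, h1]
    exact ⟨h2, hcard c hc.1 hc.2.1, by simp, by simp⟩
  · intro c hc d hd h
    simp only [coe_filter, mem_univ, true_and, Set.mem_ofPred_eq] at hc hd
    have h1 := (hf c hc).1
    rw [h, (hf d hd).1] at h1
    have : c ∈ ({a, b, d} : Finset (Option F)) := by simp [h1]
    simpa [hc.1, hc.2.1] using this
  · intro x hx
    simp only [coe_filter, Set.mem_ofPred_eq, mem_withSyndrome] at hx
    obtain ⟨hxs, hx3, ha, hb⟩ := hx
    have hle : ({a, b} : Finset (Option F)) ⊆ vecSupport x := by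
      intro t ht
      rw [mem_insert, mem_singleton] at ht
      rcases ht with rfl | rfl <;> assumption
    have h1 : #(vecSupport x \ {a, b}) = 1 := by
      rw [card_sdiff_of_subset hle, card_vecSupport, hx3, card_pair hab]
    obtain ⟨c, hc⟩ := card_eq_one.1 h1
    have hsupp : vecSupport x = {a, b, c} := by
      rw [← union_sdiff_of_subset hle, hc]
      ext t
      simp
    have hcm : c ∈ vecSupport x \ {a, b} := by simp [hc]
    simp only [mem_sdiff, mem_insert, mem_singleton, not_or] at hcm
    have hc' : c ≠ a ∧ c ≠ b ∧ polar s a b c = 0 :=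
      ⟨hcm.2.1, hcm.2.2, (polar_eq_zero_iff hm hq s hab (Ne.symm hcm.2.1) (Ne.symm hcm.2.2)).2
        ⟨x, hsupp.subset, hxs⟩⟩
    refine ⟨c, by simpa using hc', ?_⟩
    refine eq_of_mulVec_eq hm hq (S := {a, b, c}) (by rw [hcard c hc'.1 hc'.2.1]; omega)
      (hf c hc').1.subset hsupp.subset ((hf c hc').2.trans hxs.symm)

/-- Double counting of leaders against ordered pairs of distinct points in their supports: each
leader has `3 * 2` of them. -/
theorem six_mul_card_weight_three {m : Option F → F} (hm : ∀ t, m t ≠ 0)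
    (hq : 3 ≤ Fintype.card F) {s : Fin 4 → F}
    (hs : ∀ x ∈ withSyndrome m s, 3 ≤ hammingNorm x) :
    6 * #{x ∈ withSyndrome m s | hammingNorm x = 3} =
      ∑ p ∈ (univ : Finset (Option F)).offDiag,
        #{c | c ≠ p.1 ∧ c ≠ p.2 ∧ polar s p.1 p.2 c = 0} := by
  have h1 : ∀ p ∈ (univ : Finset (Option F)).offDiag,
      #{c | c ≠ p.1 ∧ c ≠ p.2 ∧ polar s p.1 p.2 c = 0} =
        #(bipartiteBelow (fun (x : Option F → F) (p : Option F × Option F) =>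
          p.1 ∈ vecSupport x ∧ p.2 ∈ vecSupport x)
          {x ∈ withSyndrome m s | hammingNorm x = 3} p) := by
    rintro ⟨a, b⟩ hp
    rw [← card_weight_three_support_pair hm hq hs (by simpa using hp), bipartiteBelow,
      filter_filter]
  rw [sum_congr rfl h1, ← sum_card_bipartiteAbove_eq_sum_card_bipartiteBelow, mul_comm]
  symm
  refine sum_const_nat fun x hx => ?_
  have h3 : #(vecSupport x) = 3 := (mem_filter.1 hx).2
  have : bipartiteAbove (fun (x : Option F → F) (p : Option F × Option F) =>
      p.1 ∈ vecSupport x ∧ p.2 ∈ vecSupport x) (univ : Finset (Option F)).offDiag x =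
      (vecSupport x).offDiag := by
    ext p
    simp only [bipartiteAbove, mem_filter, mem_offDiag, mem_univ, true_and]
    tauto
  rw [this, offDiag_card, h3]

theorem card_weight_three_eq {m : Option F → F} (hm : ∀ t, m t ≠ 0) (hq : 3 ≤ Fintype.card F)
    {s : Fin 4 → F} (hs : ∀ x ∈ withSyndrome m s, 3 ≤ hammingNorm x) :
    6 * #{x ∈ withSyndrome m s | hammingNorm x = 3} + 2 * (Fintype.card F + 1) +
      2 * (Fintype.card F * #(tangentParams s)) =
        (Fintype.card F + 1) * Fintype.card F + 2 * #(cubicZeros s) ∧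
      #(tangentParams s) ≤ 1 ∧
      (#(cubicZeros s) ≤ 3 ∨ 3 ∣ Fintype.card F ∧ #(cubicZeros s) = Fintype.card F + 1 ∧
        #(tangentParams s) = 1) := by
  have hchord : ∀ a b, a ≠ b → ¬ ∀ c, polar s a b c = 0 := by
    intro a b hab h
    obtain ⟨x, hx, hxs⟩ := exists_support_subset_pair hm hq s hab h
    have h1 := hs x (mem_withSyndrome.2 hxs)
    have h2 := card_le_card hx
    rw [card_pair hab, card_vecSupport] at h2
    omega
  refine ⟨?_, card_tangentParams_le_one hchord, ?_⟩
  · rw [six_mul_card_weight_three hm hq hs, sum_card_polar_eq_zero hchord]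
  · by_cases h : s 0 = 0 ∧ 3 * s 1 = 0 ∧ 3 * s 2 = 0 ∧ s 3 = 0
    · right
      -- Otherwise `s = 0` and the coset would be the code itself, which contains the zero vector.
      have h3 : (3 : F) = 0 := by
        by_contra h3
        have h1 := (mul_eq_zero.1 h.2.1).resolve_left h3
        have h2 := (mul_eq_zero.1 h.2.2.1).resolve_left h3
        have h0 : s = 0 := by
          funext i
          fin_cases i
          exacts [h.1, h1, h2, h.2.2.2]
        have := hs 0 (mem_withSyndrome.2 (by rw [Matrix.mulVec_zero, h0]))
        simp at this
      refine ⟨three_eq_zero_iff.1 h3, card_cubicZeros_of_eq_zero h, ?_⟩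
      exact le_antisymm (card_tangentParams_le_one hchord)
        (card_pos.2 (tangentParams_nonempty h.1 h.2.2.2 h3))
    · exact Or.inl (card_cubicZeros_le_three h)

/-- The possible numbers of planes, by divisibility. -/
theorem arith_of_zeros_tangents {q B z t : ℕ}
    (h : 6 * B + 2 * (q + 1) + 2 * (q * t) = (q + 1) * q + 2 * z) (ht : t ≤ 1)
    (hz : z ≤ 3 ∨ 3 ∣ q ∧ z = q + 1 ∧ t = 1) :
    (q % 3 = 1 → 6 * B + 3 * q = q ^ 2 + 2 ∨ 6 * B + q = q ^ 2) ∧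
    (q % 3 = 2 → 6 * B + 3 * q = q ^ 2 + 2 ∨ 6 * B + q + 2 = q ^ 2 ∨ 6 * B + q = q ^ 2 + 4) ∧
    (q % 3 = 0 → 6 * B + 3 * q = q ^ 2 ∨ 6 * B + q = q ^ 2) := by
  -- Once `t` is 0 or 1 the equation is linear in `B`, `z`, `q` and `q ^ 2`; the residue of `q ^ 2`
  -- mod 3 fixes that of `z`.
  have hsq : (q + 1) * q = q ^ 2 + q := by ring
  have hmod : q ^ 2 % 3 = (q % 3) ^ 2 % 3 := Nat.pow_mod q 2 3
  rw [hsq] at h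
  interval_cases t
  · rw [mul_zero] at h
    have hz3 : z ≤ 3 := by omega
    refine ⟨fun h3 => ?_, fun h3 => ?_, fun h3 => ?_⟩ <;> rw [h3] at hmod <;> norm_num at hmod <;>
      omega
  · rw [mul_one] at h
    refine ⟨fun h3 => ?_, fun h3 => ?_, fun h3 => ?_⟩ <;> rw [h3] at hmod <;> norm_num at hmod <;>
      omega

end Coset

theorem theorem4p4 {F : Type*} [Field F] [Fintype F] [DecidableEq F]
    (q : ℕ) (hq : Fintype.card F = q) (hq5 : 5 ≤ q)
    (m : Option F → F) (hm : ∀ t, m t ≠ 0)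
    (V : Set (Option F → F)) (hV : IsCodeCoset (cubicCode m) V) (hV3 : minWeight V = 3) :
    (weightCount V 0 = 0 ∧ weightCount V 1 = 0 ∧ weightCount V 2 = 0) ∧
    (q % 3 = 1 → (weightCount V 3 : ℚ) ∈
      ({((q : ℚ) ^ 2 - 3 * q + 2) / 6, ((q : ℚ) ^ 2 - q) / 6} : Set ℚ)) ∧
    (q % 3 = 2 → (weightCount V 3 : ℚ) ∈
      ({((q : ℚ) ^ 2 - 3 * q + 2) / 6, ((q : ℚ) ^ 2 - q - 2) / 6,
        ((q : ℚ) ^ 2 - q + 4) / 6} : Set ℚ)) ∧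
    (q % 3 = 0 → (weightCount V 3 : ℚ) ∈
      ({((q : ℚ) ^ 2 - 3 * q) / 6, ((q : ℚ) ^ 2 - q) / 6} : Set ℚ)) ∧
    (weightCount V 4 : ℤ) = ((q + 1).choose 4 : ℤ) - ((q : ℤ) - 2) * weightCount V 3 ∧
    ∀ w : ℕ, 5 ≤ w →
      (weightCount V w : ℤ) = weightCount (cubicCode m : Set (Option F → F)) w +
        (-1) ^ w * (((q + 1).choose w : ℤ) * ((w - 1).choose 3 : ℤ) -
          ((q - 2).choose (w - 3) : ℤ) * weightCount V 3) := by
  obtain ⟨s, rfl⟩ := hV.exists_eq_withSyndrome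
  subst hq
  have hq3 : 3 ≤ Fintype.card F := by omega
  have hs : ∀ x ∈ withSyndrome m s, 3 ≤ hammingNorm x := fun x hx => by
    rw [← hV3]
    exact Nat.sInf_le ⟨x, hx, rfl⟩
  have hlow : ∀ w < 3, weightCount (withSyndrome m s : Set (Option F → F)) w = 0 := by
    intro w hw
    rw [weightCount_coe, Finset.card_eq_zero, Finset.filter_eq_empty_iff]
    intro x hx h
    have := hs x hx
    omega
  obtain ⟨h1, h2, h3⟩ := card_weight_three_eq hm hq3 hs
  obtain ⟨c1, c2, c0⟩ := arith_of_zeros_tangents h1 h2 h3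
  rw [← weightCount_coe] at c1 c2 c0
  refine ⟨⟨hlow 0 (by omega), hlow 1 (by omega), hlow 2 (by omega)⟩, fun h => ?_, fun h => ?_,
    fun h => ?_, ?_, fun w hw => ?_⟩
  · simp only [Set.mem_insert_iff, Set.mem_singleton_iff]
    refine (c1 h).imp ?_ ?_ <;>
    · intro e
      qify at e
      linarith
  · simp only [Set.mem_insert_iff, Set.mem_singleton_iff]
    refine (c2 h).imp ?_ (Or.imp ?_ ?_) <;>
    · intro e
      qify at e
      linarith
  · simp only [Set.mem_insert_iff, Set.mem_singleton_iff]
    refine (c0 h).imp ?_ ?_ <;>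
    · intro e
      qify at e
      linarith
  -- Weight four is the general formula with `A_4 = 0`, `(4 - 1).choose 3 = 1` and `(q - 2).choose 1
  -- = q - 2`.
  · have h4 := card_weight_eq hm hq3 hs le_rfl
    rw [card_codeword_weight_four hm hq3] at h4
    rw [weightCount_coe, weightCount_coe, h4]
    have h5 : ((Fintype.card F - 2 : ℕ) : ℤ) = (Fintype.card F : ℤ) - 2 := by
      rw [Nat.cast_sub (by omega)]
      rfl
    simp [h5]
  · rw [coe_cubicCode_eq_withSyndrome, weightCount_coe, weightCount_coe, weightCount_coe]
    exact card_weight_eq hm hq3 hs (by omega)
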